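/- Let $V$ be the real vector space of self-adjoint matrices in $M_2\otimes M_2\otimes M_2$ (three qubits, with subsystems $A,B,C$), regarded as $8\times 8$ matrices with respect to the lexicographic order of indices, and let $\langle x,y\rangle=\mathrm{Tr}(xy^{\mathrm t})$ on $V$, where ${}^{\mathrm t}$ is the transpose. Let $\alpha,\beta,\gamma\subset V$ be the convex cones of un-normalized $A$-$BC$, $B$-$CA$ and $C$-$AB$ separable states, that is, the convex cones generated by the matrices $|v\rangle\langle v|$ where $v$ is a product vector $\xi\otimes\eta$ with respect to the bipartition in question. For a convex cone $\sigma\subset V$ put $\sigma^\circ=\{y\in V:\langle x,y\rangle\ge 0 \text{ for all } x\in\sigma\}$. For convex cones, $\wedge$ denotes the intersection and $\vee$ the convex hull of the union (equivalently, the sum). For $s,t\in\mathbb R^4$ and $u\in\mathbb C^4$ let $\mathsf X(s,t,u)\in V$ be the matrix with diagonal $(s_1,s_2,s_3,s_4,t_4,t_3,t_2,t_1)$, with anti-diagonal $(u_1,u_2,u_3,u_4,\bar u_4,\bar u_3,\bar u_2,\bar u_1)$ read from the first row to the last, and with all other entries zero. The $\mathsf X$-part of $W\in V$ is obtained by replacing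 by zero all entries that are neither diagonal nor anti-diagonal; $W$ is $\mathsf X$-shaped if it equals its $\mathsf X$-part. When $s_i,t_i\ge 0$ for $i=1,2,3,4$, consider for a pair $\{i,j\}$ with $i\ne j$ and $\{i,j,k,\ell\}=\{1,2,3,4\}$ the inequalities $$ \begin{aligned} W_2[i,j]:&\quad \sum_{m\ne j}\sqrt{s_mt_m}\ge |u_i|\quad\text{and}\quad \sum_{m\ne i}\sqrt{s_mt_m}\ge |u_j|,\\ W_3:&\quad \sum_{m=1}^4\sqrt{s_mt_m}\ge\sum_{m=1}^4|u_m|,\\ W_{4{\rm a}}[i,j]:&\quad \sqrt{s_it_i}+\sqrt{s_jt_j}+2\min\{\sqrt{s_kt_k},\sqrt{s_\ell t_\ell}\}\ge |u_i|+|u_j|,\\ W_{4{\rm b}}[i,j]:&\quad \sqrt{s_it_i}+\sqrt{s_jt_j}+2\left(\sqrt{s_kt_k}+\sqrt{s_\ell t_\ell}\right)\ge |u_i|+|u_j|+2\max\{|u_k|,|u_\ell|\}, \end{aligned} $$ and let $W_4[i,j]$ mean both $W_{4{\rm a}}[i,j]$ and $W_{4{\rm b}}[i,j]$. **Theorem.**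 Let $W\in V$ have $\mathsf X$-part $\mathsf X(s,t,u)$. If $W$ belongs to $$\alpha^\circ\vee(\beta^\circ\wedge\gamma^\circ)\qquad(\text{respectively } \beta^\circ\vee(\gamma^\circ\wedge\alpha^\circ)\text{ and } \gamma^\circ\vee(\alpha^\circ\wedge\beta^\circ)),$$ then $s_i,t_i\ge 0$ for $i=1,2,3,4$, and $W$ satisfies $W_3$ together with the following: (i) $W_2[i,j]$ whenever $\{i,j\}$ is one of $\{1,2\},\{1,3\},\{2,4\},\{3,4\}$ (respectively $\{1,2\},\{1,4\},\{2,3\},\{3,4\}$ and $\{1,3\},\{1,4\},\{2,3\},\{2,4\}$); (ii) $W_4[i,j]$ whenever $\{i,j\}$ is one of $\{1,4\},\{2,3\}$ (respectively $\{1,3\},\{2,4\}$ and $\{1,2\},\{3,4\}$). Conversely, if $W$ is $\mathsf X$-shaped, if $s_i,t_i\ge 0$ for $i=1,2,3,4$, and if $W$ satisfies $W_3$, (i) and (ii), then $W$ belongs to the corresponding convex cone. -/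

import Mathlib

noncomputable section

namespace ThreeQubit

open Matrix

/-- Basis labels `(i, j, k)` of `ℂ² ⊗ ℂ² ⊗ ℂ²`, the entries belonging to the subsystems
`A`, `B`, `C` in this order. -/
abbrev Idx : Type := Fin 2 × Fin 2 × Fin 2

/-- The 64-dimensional real vector space of self-adjoint three qubit matrices. -/
abbrev SA : Type := selfAdjoint (Matrix Idx Idx ℂ)

/-- The pairing `⟨x, y⟩ = Tr (x yᵀ)`; on self-adjoint matrices this trace is real. -/
def pairing : SA →ₗ[ℝ] SA →ₗ[ℝ] ℝ :=
  LinearMap.mk₂ ℝ (fun x y => (trace (x.1 * (y.1)ᵀ)).re)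
    (fun x x' y => by simp [add_mul])
    (fun c x y => by simp)
    (fun x y y' => by simp [mul_add])
    (fun c x y => by simp)

/-- The rank one matrix `|v⟩⟨v|`: an un-normalized pure state. -/
def pureState (v : Idx → ℂ) : SA :=
  ⟨vecMulVec v (star v), by
    ext p q
    simp [star_apply, vecMulVec_apply, mul_comm]⟩

/-- `α`: the cone of un-normalized `A`-`BC` separable states, generated by the pure states
of product vectors `ξ ⊗ η` with `ξ` in `A` and `η` in `BC`. -/
def alpha : PointedCone ℝ SA :=
  PointedCone.hull ℝ {ρ | ∃ (ξ : Fin 2 → ℂ) (η : Fin 2 × Fin 2 → ℂ),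
    ρ = pureState fun p => ξ p.1 * η (p.2.1, p.2.2)}

/-- `β`: the cone of un-normalized `B`-`CA` separable states. -/
def beta : PointedCone ℝ SA :=
  PointedCone.hull ℝ {ρ | ∃ (ξ : Fin 2 → ℂ) (η : Fin 2 × Fin 2 → ℂ),
    ρ = pureState fun p => ξ p.2.1 * η (p.2.2, p.1)}

/-- `γ`: the cone of un-normalized `C`-`AB` separable states. -/
def gamma : PointedCone ℝ SA :=
  PointedCone.hull ℝ {ρ | ∃ (ξ : Fin 2 → ℂ) (η : Fin 2 × Fin 2 → ℂ),
    ρ = pureState fun p => ξ p.2.2 * η (p.1, p.2.1)}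

/-- The dual cone `σ°` of all `y` with `⟨x, y⟩ ≥ 0` for every `x ∈ σ`. -/
def dualCone (σ : PointedCone ℝ SA) : PointedCone ℝ SA :=
  PointedCone.dual pairing (σ : Set SA)

/-- The first four labels in lexicographic order: `000, 001, 010, 011`. -/
def pos : Fin 4 → Idx := ![(0, 0, 0), (0, 0, 1), (0, 1, 0), (0, 1, 1)]

/-- The label on the anti-diagonal in the row `p`: all three bits are flipped. In lexicographic
order this reverses the eight labels. -/
def flip (p : Idx) : Idx := (1 - p.1, 1 - p.2.1, 1 - p.2.2)

/-- The matrix `X(s,t,u)`, with diagonal `s₁, s₂, s₃, s₄, t₄, t₃, t₂, t₁` and anti-diagonal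
`u₁, u₂, u₃, u₄, ū₄, ū₃, ū₂, ū₁` (from the first row to the last one). The indices
`1, 2, 3, 4` are represented by `0, 1, 2, 3 : Fin 4`. -/
def xMatrix (s t : Fin 4 → ℝ) (u : Fin 4 → ℂ) : Matrix Idx Idx ℂ :=
  ∑ i, (Matrix.single (pos i) (pos i) (s i : ℂ)
    + Matrix.single (flip (pos i)) (flip (pos i)) (t i : ℂ)
    + Matrix.single (pos i) (flip (pos i)) (u i)
    + Matrix.single (flip (pos i)) (pos i) (star (u i)))

/-- The X-part of a matrix: all entries off the diagonal and the anti-diagonal are replaced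
by zero. -/
def xPart (W : Matrix Idx Idx ℂ) : Matrix Idx Idx ℂ :=
  Matrix.of fun p q => if q = p ∨ q = flip p then W p q else 0

/-- A matrix is X-shaped if it vanishes off the diagonal and the anti-diagonal. -/
def IsXShaped (W : Matrix Idx Idx ℂ) : Prop :=
  ∀ p q, q ≠ p → q ≠ flip p → W p q = 0

/-- The inequalities `W₂[i,j]`. -/
def W2 (s t : Fin 4 → ℝ) (u : Fin 4 → ℂ) (i j : Fin 4) : Prop :=
  ‖u i‖ ≤ ∑ k ∈ Finset.univ.erase j, √(s k * t k) ∧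
  ‖u j‖ ≤ ∑ k ∈ Finset.univ.erase i, √(s k * t k)

/-- The inequality `W₃`. -/
def W3 (s t : Fin 4 → ℝ) (u : Fin 4 → ℂ) : Prop :=
  ∑ i, ‖u i‖ ≤ ∑ i, √(s i * t i)

/-- The inequality `W₄ₐ[i,j]`, for `i ≠ j`; the two other indices are `k` and `l`. -/
def W4a (s t : Fin 4 → ℝ) (u : Fin 4 → ℂ) (i j : Fin 4) : Prop :=
  ∀ k l : Fin 4, ({i, j, k, l} : Finset (Fin 4)) = Finset.univ →
    ‖u i‖ + ‖u j‖ ≤ √(s i * t i) + √(s j * t j) + 2 * min √(s k * t k) √(s l * t l)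

/-- The inequality `W₄ᵦ[i,j]`, for `i ≠ j`; the two other indices are `k` and `l`. -/
def W4b (s t : Fin 4 → ℝ) (u : Fin 4 → ℂ) (i j : Fin 4) : Prop :=
  ∀ k l : Fin 4, ({i, j, k, l} : Finset (Fin 4)) = Finset.univ →
    ‖u i‖ + ‖u j‖ + 2 * max ‖u k‖ ‖u l‖ ≤
      √(s i * t i) + √(s j * t j) + 2 * (√(s k * t k) + √(s l * t l))

/-- The combined inequality `W₄[i,j]`. -/
def W4 (s t : Fin 4 → ℝ) (u : Fin 4 → ℂ) (i j : Fin 4) : Prop :=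
  W4a s t u i j ∧ W4b s t u i j

end ThreeQubit

end

/-!
Up to complex conjugation of vectors, the dual of a cone of biseparable states consists of the
matrices whose Hermitian form is nonnegative on the product vectors of the bipartition. Product
vectors are stable under the four sign matrices `1`, `Z ⊗ Z ⊗ 1`, `Z ⊗ 1 ⊗ Z`, `1 ⊗ Z ⊗ Z`, and
the average of the conjugates of `W` by these is the X-part of `W` (`sum_pairing_parity`). Hence
the X-part of an element of a dual cone stays in that cone, and only X-shaped matrices matter.

On product vectors the form of an X-shaped matrix splits into two forms, each of which involves
the entries `s i, t i, u i` for two of the four indices `i` (`pairForm`). By the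
arithmetic-geometric mean inequality and a suitable choice of moduli and phases, such a form is
nonnegative if and only if the diagonal is and `|u| + |u'| ≤ √(s t) + √(s' t')`
(`pairForm_nonneg_iff`). The couples of indices are `03|12` for `A`-`BC`, `02|13` for `B`-`CA` and
`01|23` for `C`-`AB` (`hasXCriterion_alpha`, `hasXCriterion_beta`, `hasXCriterion_gamma`).

For the join, write `W = P + Q` with `P` in the first cone and `Q` in the two others. Since
geometric means are superadditive and absolute values subadditive, all inequalities are sums of
the ones for `P` and `Q` (`joinCondition_of_mem`). Conversely, distributing the entries of an
X-shaped `W` to `P` and `Q` is a linear feasibility problem in four real unknowns, the excesses of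
`√(s t)` over `|u|` to be given to `Q` at each index. The inequalities of the theorem are exactly
what is needed to solve it (`exists_excess`, `mem_of_joinCondition`).
-/

noncomputable section

namespace ThreeQubit

open Matrix

/-! ### The form of a matrix and of its X-part -/

theorem pairing_pureState (v : Idx → ℂ) (W : SA) :
    pairing (pureState v) W = (∑ p, ∑ q, v p * star (v q) * W.1 p q).re := by
  simp [pairing, pureState, trace, mul_apply, vecMulVec_apply]

/-- The real number `∑ v_p v̄_q X(s,t,u)_{pq}`, the value of the Hermitian form of `X(s,t,u)`
(up to conjugation of `v`, as in `pairing`). -/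
def xForm (s t : Fin 4 → ℝ) (u : Fin 4 → ℂ) (v : Idx → ℂ) : ℝ :=
  ∑ i, (s i * ‖v (pos i)‖ ^ 2 + t i * ‖v (flip (pos i))‖ ^ 2
    + 2 * (v (pos i) * star (v (flip (pos i))) * u i).re)

theorem sum_xMatrix (s t : Fin 4 → ℝ) (u : Fin 4 → ℂ) (v : Idx → ℂ) :
    (∑ p, ∑ q, v p * star (v q) * xMatrix s t u p q).re = xForm s t u v := by
  have key (a b : Idx) (c : ℂ) :
      ∑ p, ∑ q, v p * star (v q) * Matrix.single a b c p q = v a * star (v b) * c := by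
    rw [Finset.sum_eq_single a, Finset.sum_eq_single b, Matrix.single_apply_same]
    · intro q _ hq
      rw [Matrix.single_apply_of_col_ne _ _ hq.symm, mul_zero]
    · exact fun h => absurd (Finset.mem_univ _) h
    · intro p _ hp
      exact Finset.sum_eq_zero fun q _ => by
        rw [Matrix.single_apply_of_row_ne hp.symm _ _, mul_zero]
    · exact fun h => absurd (Finset.mem_univ _) h
  have h : ∑ p, ∑ q, v p * star (v q) * xMatrix s t u p q =
      ∑ i, (v (pos i) * star (v (pos i)) * (s i : ℂ)
        + v (flip (pos i)) * star (v (flip (pos i))) * (t i : ℂ)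
        + v (pos i) * star (v (flip (pos i))) * u i
        + v (flip (pos i)) * star (v (pos i)) * star (u i)) := by
    simp only [xMatrix, Matrix.sum_apply, Finset.mul_sum]
    rw [Finset.sum_congr rfl fun p _ => Finset.sum_comm, Finset.sum_comm]
    refine Finset.sum_congr rfl fun i _ => ?_
    simp only [Matrix.add_apply, mul_add, Finset.sum_add_distrib, key]
  rw [h, Complex.re_sum, xForm]
  refine Finset.sum_congr rfl fun i _ => ?_
  simp only [← Complex.normSq_eq_norm_sq, Complex.normSq_apply]
  simp
  ring

/-- The diagonal of the product of Pauli matrices `Zˣ ⊗ Zʸ ⊗ Zˣ⁺ʸ`. These four local sign matrices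
form a group, and the X-part is the average of the conjugates of a matrix by them. -/
def parity (x y : Fin 2) (p : Idx) : ℤ :=
  (-1) ^ (x.val * p.1.val) * (-1) ^ (y.val * p.2.1.val) * (-1) ^ ((x + y).val * p.2.2.val)

theorem sum_parity (p q : Idx) :
    ∑ x, ∑ y, parity x y p * parity x y q = if q = p ∨ q = flip p then 4 else 0 := by
  revert p q; decide

/-- Twirling: averaging the form of `W` over the four sign changes of `v` leaves the form of the
X-part of `W`. -/
theorem sum_pairing_parity {W : SA} {s t : Fin 4 → ℝ} {u : Fin 4 → ℂ}
    (hX : xPart W.1 = xMatrix s t u) (v : Idx → ℂ) :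
    ∑ x, ∑ y, pairing (pureState fun p => (parity x y p : ℂ) * v p) W = 4 * xForm s t u v := by
  simp only [pairing_pureState, ← Complex.re_sum, ← sum_xMatrix, ← hX]
  rw [show (4 : ℝ) * _ = ((4 : ℂ) * ∑ p, ∑ q, v p * star (v q) * xPart W.1 p q).re by simp]
  congr 1
  have h1 : ∀ x y : Fin 2,
      ∑ p, ∑ q, (parity x y p : ℂ) * v p * star ((parity x y q : ℂ) * v q) * W.1 p q
      = ∑ p, ∑ q, ((parity x y p * parity x y q : ℤ) : ℂ) * (v p * star (v q) * W.1 p q) := by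
    intro x y
    refine Finset.sum_congr rfl fun p _ => Finset.sum_congr rfl fun q _ => ?_
    simp
    ring
  simp only [h1]
  simp only [Finset.sum_comm (s := (Finset.univ : Finset (Fin 2))) (t := (Finset.univ : Finset Idx)),
    ← Finset.sum_mul, ← Int.cast_sum, sum_parity, Finset.mul_sum]
  refine Finset.sum_congr rfl fun p _ => Finset.sum_congr rfl fun q _ => ?_
  simp only [xPart, Matrix.of_apply]
  split_ifs <;> simp

/-! ### Nonnegativity of the form of a couple of indices -/

theorem two_mul_sqrt_mul_le {s t : ℝ} (hs : 0 ≤ s) (ht : 0 ≤ t) (x y : ℝ) :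
    2 * √(s * t) * (x * y) ≤ s * x ^ 2 + t * y ^ 2 := by
  rw [Real.sqrt_mul hs]
  nlinarith [sq_nonneg (√s * x - √t * y), Real.sq_sqrt hs, Real.sq_sqrt ht]

/-- Superadditivity of the geometric mean. -/
theorem sqrt_add_sqrt_le {s t s' t' : ℝ} (hs : 0 ≤ s) (ht : 0 ≤ t) (hs' : 0 ≤ s') (ht' : 0 ≤ t') :
    √(s * t) + √(s' * t') ≤ √((s + s') * (t + t')) := by
  apply Real.le_sqrt_of_sq_le
  have := two_mul_sqrt_mul_le (mul_nonneg hs ht') (mul_nonneg hs' ht) 1 1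
  have e : √(s * t') * √(s' * t) = √(s * t) * √(s' * t') := by
    rw [← Real.sqrt_mul (by positivity), ← Real.sqrt_mul (by positivity)]; ring_nf
  rw [Real.sqrt_mul (by positivity), e] at this
  nlinarith [Real.sq_sqrt (mul_nonneg hs ht), Real.sq_sqrt (mul_nonneg hs' ht')]

/-- The form of two coupled Hermitian blocks `(s, u; ū, t)` and `(s', u'; ū', t')` at a product vector
with factors `(a, b)` and `(c, d)`: the amplitudes in the first block are `ac` and `bd`, those in the
second are `ad` and `bc`. A coupling that exchanges the two amplitudes in the second block is covered
by exchanging `s'` and `t'` and conjugating `u'`. -/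
def pairForm (s t : ℝ) (u : ℂ) (s' t' : ℝ) (u' : ℂ) (a b c d : ℂ) : ℝ :=
  s * ‖a * c‖ ^ 2 + t * ‖b * d‖ ^ 2 + 2 * (a * c * star (b * d) * u).re
    + (s' * ‖a * d‖ ^ 2 + t' * ‖b * c‖ ^ 2 + 2 * (a * d * star (b * c) * u').re)

theorem pairForm_nonneg {s t : ℝ} {u : ℂ} {s' t' : ℝ} {u' : ℂ} (hs : 0 ≤ s) (ht : 0 ≤ t)
    (hs' : 0 ≤ s') (ht' : 0 ≤ t') (h : ‖u‖ + ‖u'‖ ≤ √(s * t) + √(s' * t')) (a b c d : ℂ) :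
    0 ≤ pairForm s t u s' t' u' a b c d := by
  have h1 := two_mul_sqrt_mul_le hs ht ‖a * c‖ ‖b * d‖
  have h2 := two_mul_sqrt_mul_le hs' ht' ‖a * d‖ ‖b * c‖
  have h3 := (abs_le.1 (Complex.abs_re_le_norm (a * c * star (b * d) * u))).1
  have h4 := (abs_le.1 (Complex.abs_re_le_norm (a * d * star (b * c) * u'))).1
  have h5 := mul_le_mul_of_nonneg_left h (by positivity : 0 ≤ ‖a‖ * ‖b‖ * ‖c‖ * ‖d‖)
  simp only [norm_mul, norm_star] at h1 h2 h3 h4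
  simp only [pairForm, norm_mul]
  linarith

/-- The phases of the two factors of a product vector can be tuned so that both off-diagonal
contributions are as negative as possible at the same time. -/
theorem exists_phases (u u' : ℂ) : ∃ z w : ℂ, ‖z‖ = 1 ∧ ‖w‖ = 1 ∧
    star (z * w) * u = -‖u‖ ∧ w * star z * u' = -‖u'‖ := by
  have polar (u : ℂ) : ∃ r θ : ℝ, u = r * Complex.exp (θ * Complex.I) ∧ ‖u‖ = r :=
    ⟨‖u‖, u.arg, (Complex.norm_mul_exp_arg_mul_I u).symm, rfl⟩
  have hπ : Complex.exp (-(Real.pi * Complex.I)) = -1 := by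
    rw [Complex.exp_neg, Complex.exp_pi_mul_I]; norm_num
  obtain ⟨r, θ, hu, hr⟩ := polar u
  obtain ⟨r', θ', hu', hr'⟩ := polar u'
  refine ⟨Complex.exp (((θ + θ') / 2 + Real.pi : ℝ) * Complex.I),
    Complex.exp (((θ - θ') / 2 : ℝ) * Complex.I),
    Complex.norm_exp_ofReal_mul_I _, Complex.norm_exp_ofReal_mul_I _, ?_, ?_⟩
  · rw [hr, hu, ← mul_neg_one (r : ℂ), ← hπ]
    simp only [Complex.star_def, map_mul, ← Complex.exp_conj, Complex.conj_ofReal, Complex.conj_I]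
    rw [mul_left_comm, ← Complex.exp_add, ← Complex.exp_add]
    congr 2
    push_cast
    ring
  · rw [hr', hu', ← mul_neg_one (r' : ℂ), ← hπ]
    simp only [Complex.star_def, map_mul, ← Complex.exp_conj, Complex.conj_ofReal, Complex.conj_I]
    rw [mul_left_comm, ← Complex.exp_add, ← Complex.exp_add]
    congr 2
    push_cast
    ring

/-- With a strictly positive diagonal, one product vector turns both arithmetic-geometric mean
inequalities of `pairForm_nonneg` into equalities. -/
theorem norm_add_norm_le_of_pos {s t : ℝ} {u : ℂ} {s' t' : ℝ} {u' : ℂ} (hs : 0 < s) (ht : 0 < t)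
    (hs' : 0 < s') (ht' : 0 < t') (h : ∀ a b c d, 0 ≤ pairForm s t u s' t' u' a b c d) :
    ‖u‖ + ‖u'‖ ≤ √(s * t) + √(s' * t') := by
  obtain ⟨z, w, hz, hw, h1, h2⟩ := exists_phases u u'
  have root {x : ℝ} (hx : 0 < x) : ∃ y, 0 < y ∧ x = y ^ 4 :=
    ⟨√√x, by positivity, by
      rw [show 4 = 2 * 2 from rfl, pow_mul, Real.sq_sqrt (by positivity), Real.sq_sqrt hx.le]⟩
  obtain ⟨σ, hσ, rfl⟩ := root hs
  obtain ⟨τ, hτ, rfl⟩ := root ht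
  obtain ⟨σ', hσ', rfl⟩ := root hs'
  obtain ⟨τ', hτ', rfl⟩ := root ht'
  -- These moduli equate the two diagonal terms of each block:
  -- `s |ac|² = t |bd|²` and `s' |ad|² = t' |bc|²`.
  have key := h (τ * τ' : ℝ) ((σ * σ' : ℝ) * z) (τ * σ' : ℝ) ((σ * τ' : ℝ) * w)
  have e1 : ((τ * τ' : ℝ) : ℂ) * (τ * σ' : ℝ) * star ((σ * σ' : ℝ) * z * ((σ * τ' : ℝ) * w)) * u
      = ((-((σ * τ * σ' * τ') ^ 2 * ‖u‖) : ℝ) : ℂ) := by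
    simp only [Complex.star_def, map_mul, Complex.conj_ofReal] at h1 ⊢
    push_cast
    linear_combination (σ * τ * σ' * τ' : ℂ) ^ 2 * h1
  have e2 : ((τ * τ' : ℝ) : ℂ) * ((σ * τ' : ℝ) * w) * star ((σ * σ' : ℝ) * z * (τ * σ' : ℝ)) * u'
      = ((-((σ * τ * σ' * τ') ^ 2 * ‖u'‖) : ℝ) : ℂ) := by
    simp only [Complex.star_def, map_mul, Complex.conj_ofReal] at h2 ⊢
    push_cast
    linear_combination (σ * τ * σ' * τ' : ℂ) ^ 2 * h2
  rw [pairForm, e1, e2, Complex.ofReal_re, Complex.ofReal_re] at key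
  simp only [norm_mul, hz, hw, Complex.norm_real, Real.norm_eq_abs, abs_of_pos hσ, abs_of_pos hτ,
    abs_of_pos hσ', abs_of_pos hτ'] at key
  rw [show σ ^ 4 * τ ^ 4 = ((σ * τ) ^ 2) ^ 2 by ring,
    show σ' ^ 4 * τ' ^ 4 = ((σ' * τ') ^ 2) ^ 2 by ring, Real.sqrt_sq (by positivity),
    Real.sqrt_sq (by positivity)]
  refine le_of_mul_le_mul_left ?_ (by positivity : 0 < (σ * τ * σ' * τ') ^ 2)
  linarith

theorem pairForm_nonneg_iff {s t : ℝ} {u : ℂ} {s' t' : ℝ} {u' : ℂ} :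
    (∀ a b c d, 0 ≤ pairForm s t u s' t' u' a b c d) ↔
      (0 ≤ s ∧ 0 ≤ t) ∧ (0 ≤ s' ∧ 0 ≤ t') ∧ ‖u‖ + ‖u'‖ ≤ √(s * t) + √(s' * t') := by
  refine ⟨fun h => ?_, fun ⟨⟨hs, ht⟩, ⟨hs', ht'⟩, h⟩ => pairForm_nonneg hs ht hs' ht' h⟩
  have hs : 0 ≤ s := by simpa [pairForm] using h 1 0 1 0
  have ht : 0 ≤ t := by simpa [pairForm] using h 0 1 0 1
  have hs' : 0 ≤ s' := by simpa [pairForm] using h 1 0 0 1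
  have ht' : 0 ≤ t' := by simpa [pairForm] using h 0 1 1 0
  refine ⟨⟨hs, ht⟩, ⟨hs', ht'⟩, ?_⟩
  -- The diagonal entries may vanish, so they are raised by `ε > 0`; then `ε → 0`.
  have hc : Continuous fun ε : ℝ => √((s + ε) * (t + ε)) + √((s' + ε) * (t' + ε)) := by fun_prop
  have hl := (hc.tendsto 0).mono_left (nhdsWithin_le_nhds (s := Set.Ioi 0))
  simp only [add_zero] at hl
  refine ge_of_tendsto hl ?_
  filter_upwards [self_mem_nhdsWithin] with ε (hε : 0 < ε)
  refine norm_add_norm_le_of_pos (by positivity) (by positivity) (by positivity) (by positivity)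
    fun a b c d => (h a b c d).trans ?_
  unfold pairForm
  gcongr <;> linarith

/-! ### Entries of X-shaped matrices -/

theorem pos_inj {i j : Fin 4} : pos i = pos j ↔ i = j := by revert i j; decide

theorem flip_flip (p : Idx) : flip (flip p) = p := by revert p; decide

theorem flip_inj {p q : Idx} : flip p = flip q ↔ p = q := by revert p q; decide

theorem pos_ne_flip_pos (i j : Fin 4) : pos i ≠ flip (pos j) := by revert i j; decide

theorem exists_pos_or_flip_pos (p : Idx) : ∃ i, p = pos i ∨ p = flip (pos i) := by
  revert p; decide

theorem xMatrix_pos (s t : Fin 4 → ℝ) (u : Fin 4 → ℂ) (i : Fin 4) (q : Idx) :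
    xMatrix s t u (pos i) q =
      if q = pos i then (s i : ℂ) else if q = flip (pos i) then u i else 0 := by
  rw [xMatrix, Matrix.sum_apply, Finset.sum_eq_single i]
  · simp only [Matrix.add_apply, Matrix.single_apply, (pos_ne_flip_pos _ _).symm, false_and, true_and,
      if_false, add_zero, eq_comm (a := q)]
    split_ifs with h1 h2 <;> simp
    exact absurd (h1.trans h2.symm) (pos_ne_flip_pos _ _)
  · intro j _ hj
    simp [pos_inj, hj, (pos_ne_flip_pos _ _).symm]
  · simp

theorem xMatrix_flip_pos (s t : Fin 4 → ℝ) (u : Fin 4 → ℂ) (i : Fin 4) (q : Idx) :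
    xMatrix s t u (flip (pos i)) q =
      if q = flip (pos i) then (t i : ℂ) else if q = pos i then star (u i) else 0 := by
  rw [xMatrix, Matrix.sum_apply, Finset.sum_eq_single i]
  · simp only [Matrix.add_apply, Matrix.single_apply, pos_ne_flip_pos, false_and, true_and,
      if_false, zero_add, add_zero, eq_comm (a := q)]
    split_ifs with h1 h2 <;> simp
    exact absurd (h2.trans h1.symm) (pos_ne_flip_pos _ _)
  · intro j _ hj
    simp [pos_inj, flip_inj, hj, pos_ne_flip_pos]
  · simp

theorem xMatrix_injective {s t s' t' : Fin 4 → ℝ} {u u' : Fin 4 → ℂ}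
    (h : xMatrix s t u = xMatrix s' t' u') : s = s' ∧ t = t' ∧ u = u' := by
  refine ⟨funext fun i => ?_, funext fun i => ?_, funext fun i => ?_⟩
  · simpa [xMatrix_pos] using congr_fun₂ h (pos i) (pos i)
  · simpa [xMatrix_flip_pos] using congr_fun₂ h (flip (pos i)) (flip (pos i))
  · simpa [xMatrix_pos, (pos_ne_flip_pos _ _).symm] using congr_fun₂ h (pos i) (flip (pos i))

theorem xMatrix_add (s t s' t' : Fin 4 → ℝ) (u u' : Fin 4 → ℂ) :
    xMatrix (s + s') (t + t') (u + u') = xMatrix s t u + xMatrix s' t' u' := by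
  simp only [xMatrix, ← Finset.sum_add_distrib]
  refine Finset.sum_congr rfl fun i _ => ?_
  simp only [Pi.add_apply, Complex.ofReal_add, Matrix.single_add, star_add]
  abel

theorem isSelfAdjoint_xMatrix (s t : Fin 4 → ℝ) (u : Fin 4 → ℂ) :
    IsSelfAdjoint (xMatrix s t u) := by
  rw [IsSelfAdjoint, xMatrix, star_sum]
  refine Finset.sum_congr rfl fun i _ => ?_
  simp only [star_add, star_eq_conjTranspose, Matrix.conjTranspose_single,
    Complex.star_def, Complex.conj_ofReal, Complex.conj_conj]
  abel

/-- The X-shaped self-adjoint matrix `X(s,t,u)`. -/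
def xState (s t : Fin 4 → ℝ) (u : Fin 4 → ℂ) : SA := ⟨xMatrix s t u, isSelfAdjoint_xMatrix s t u⟩

theorem xState_add (s t s' t' : Fin 4 → ℝ) (u u' : Fin 4 → ℂ) :
    xState (s + s') (t + t') (u + u') = xState s t u + xState s' t' u' :=
  Subtype.ext (xMatrix_add s t s' t' u u')

theorem eq_xState {W : SA} {s t : Fin 4 → ℝ} {u : Fin 4 → ℂ}
    (hX : xPart W.1 = xMatrix s t u) (hW : IsXShaped W.1) : W = xState s t u := by
  refine Subtype.ext (Eq.trans ?_ hX)
  ext p q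
  by_cases h : q = p ∨ q = flip p
  · simp [xPart, h]
  · simp only [xPart, Matrix.of_apply, if_neg h]
    push Not at h
    exact hW p q h.1 h.2

theorem xPart_add (P Q : Matrix Idx Idx ℂ) : xPart (P + Q) = xPart P + xPart Q := by
  ext p q
  simp only [xPart, Matrix.of_apply, Matrix.add_apply]
  split_ifs <;> simp

theorem exists_xPart_eq_xMatrix (W : SA) : ∃ s t u, xPart W.1 = xMatrix s t u := by
  have hW (p q : Idx) : star (W.1 q p) = W.1 p q := congr_fun₂ W.2 p q
  refine ⟨fun i => (W.1 (pos i) (pos i)).re, fun i => (W.1 (flip (pos i)) (flip (pos i))).re,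
    fun i => W.1 (pos i) (flip (pos i)), ?_⟩
  have hd (p : Idx) : ((W.1 p p).re : ℂ) = W.1 p p := Complex.conj_eq_iff_re.1 (hW p p)
  ext p q
  obtain ⟨i, rfl | rfl⟩ := exists_pos_or_flip_pos p
  · simp only [xPart, Matrix.of_apply, xMatrix_pos, hd]
    split_ifs <;> simp_all
  · simp only [xPart, Matrix.of_apply, xMatrix_flip_pos, hd, flip_flip, hW]
    split_ifs <;> simp_all

/-! ### The three dual cones and their X-parts -/

theorem mem_dualCone_hull {ι κ : Type*} (f : ι → κ → Idx → ℂ) (W : SA) :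
    W ∈ dualCone (PointedCone.hull ℝ {ρ | ∃ ξ η, ρ = pureState (f ξ η)}) ↔
      ∀ ξ η, 0 ≤ pairing (pureState (f ξ η)) W := by
  simp only [dualCone, PointedCone.dual_hull, PointedCone.mem_dual, Set.mem_ofPred_eq]
  aesop

/-- Block-positivity of `X(s,t,u)` for the bipartition that couples the index `i` with `j`
and `k` with `l`: the diagonal is nonnegative and each couple satisfies
`|u| + |u'| ≤ √(s t) + √(s' t')`. -/
def PairCondition (s t : Fin 4 → ℝ) (u : Fin 4 → ℂ) (i j k l : Fin 4) : Prop :=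
  (∀ m, 0 ≤ s m ∧ 0 ≤ t m) ∧ ‖u i‖ + ‖u j‖ ≤ √(s i * t i) + √(s j * t j) ∧
    ‖u k‖ + ‖u l‖ ≤ √(s k * t k) + √(s l * t l)

/-- The cone `σ` contains the X-shaped matrices satisfying `PairCondition`, and conversely the X-part
of every element of `σ`, X-shaped or not, satisfies it. -/
structure HasXCriterion (σ : PointedCone ℝ SA) (i j k l : Fin 4) : Prop where
  necessary : ∀ {W : SA} {s t : Fin 4 → ℝ} {u : Fin 4 → ℂ}, xPart W.1 = xMatrix s t u →
    W ∈ σ → PairCondition s t u i j k l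
  sufficient : ∀ {s t : Fin 4 → ℝ} {u : Fin 4 → ℂ}, PairCondition s t u i j k l →
    xState s t u ∈ σ

theorem HasXCriterion.swap {σ : PointedCone ℝ SA} {i j k l : Fin 4} (h : HasXCriterion σ i j k l) :
    HasXCriterion σ i j l k := by
  have e (s t : Fin 4 → ℝ) (u : Fin 4 → ℂ) :
      PairCondition s t u i j l k ↔ PairCondition s t u i j k l := by
    simp only [PairCondition, add_comm ‖u l‖, add_comm √(s l * t l)]
  exact ⟨fun hX hW => (e _ _ _).2 (h.necessary hX hW), fun hc => h.sufficient ((e _ _ _).1 hc)⟩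

/-- The criterion for the dual of a cone generated by pure states of product vectors `f ξ η`, when
these vectors are stable under the local sign changes `parity`. -/
theorem hasXCriterion_of_form (f : (Fin 2 → ℂ) → (Fin 2 × Fin 2 → ℂ) → Idx → ℂ) {i j k l : Fin 4}
    (hpar : ∀ x y ξ η, ∃ ξ' η', (fun p => (parity x y p : ℂ) * f ξ η p) = f ξ' η')
    (hform : ∀ s t u, (∀ ξ η, 0 ≤ xForm s t u (f ξ η)) ↔ PairCondition s t u i j k l) :
    HasXCriterion (dualCone (PointedCone.hull ℝ {ρ | ∃ ξ η, ρ = pureState (f ξ η)})) i j k l := by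
  refine ⟨fun {W s t u} hX hW => (hform s t u).1 fun ξ η => ?_, fun {s t u} hc => ?_⟩
  · rw [mem_dualCone_hull] at hW
    have h : 0 ≤ 4 * xForm s t u (f ξ η) := by
      rw [← sum_pairing_parity hX]
      refine Finset.sum_nonneg fun x _ => Finset.sum_nonneg fun y _ => ?_
      obtain ⟨ξ', η', e⟩ := hpar x y ξ η
      rw [e]
      exact hW ξ' η'
    linarith
  · rw [mem_dualCone_hull]
    intro ξ η
    rw [pairing_pureState]
    exact (sum_xMatrix s t u (f ξ η)).symm ▸ (hform s t u).2 hc ξ η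

/-- The two couples of indices use disjoint coordinates of `η`, so the sum of their forms is
nonnegative only if each form is. -/
theorem forall_pairForm_add_nonneg_iff {s₁ t₁ s₂ t₂ s₃ t₃ s₄ t₄ : ℝ} {u₁ u₂ u₃ u₄ : ℂ}
    {p q r m : Fin 2 × Fin 2} (hd : [p, q, r, m].Nodup) :
    (∀ (ξ : Fin 2 → ℂ) (η : Fin 2 × Fin 2 → ℂ),
      0 ≤ pairForm s₁ t₁ u₁ s₂ t₂ u₂ (ξ 0) (ξ 1) (η p) (η q) +
        pairForm s₃ t₃ u₃ s₄ t₄ u₄ (ξ 0) (ξ 1) (η r) (η m)) ↔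
      (∀ a b c d, 0 ≤ pairForm s₁ t₁ u₁ s₂ t₂ u₂ a b c d) ∧
        ∀ a b c d, 0 ≤ pairForm s₃ t₃ u₃ s₄ t₄ u₄ a b c d := by
  have h0 (s t s' t' : ℝ) (u u' a b : ℂ) : pairForm s t u s' t' u' a b 0 0 = 0 := by
    simp [pairForm]
  simp only [List.nodup_cons, List.mem_cons, not_or, List.not_mem_nil, not_false_iff, and_true,
    List.nodup_nil] at hd
  obtain ⟨⟨hpq, hpr, hpm⟩, ⟨hqr, hqm⟩, hrm⟩ := hd
  refine ⟨fun h => ⟨fun a b c d => ?_, fun a b c d => ?_⟩, fun h ξ η => add_nonneg (h.1 ..) (h.2 ..)⟩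
  · have := h ![a, b] (Pi.single p c + Pi.single q d)
    simpa [Pi.single_apply, hpq, Ne.symm hpq, Ne.symm hpr, Ne.symm hpm, Ne.symm hqr, Ne.symm hqm,
      h0] using this
  · have := h ![a, b] (Pi.single r c + Pi.single m d)
    simpa [Pi.single_apply, hrm, Ne.symm hrm, hpr, hpm, hqr, hqm, h0] using this

theorem hasXCriterion_alpha : HasXCriterion (dualCone alpha) 0 3 1 2 := by
  refine hasXCriterion_of_form (fun ξ η p => ξ p.1 * η (p.2.1, p.2.2)) (fun x y ξ η => ?_)
    fun s t u => ?_
  · refine ⟨fun i => (-1) ^ (x.val * i.val) * ξ i,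
      fun j => (-1) ^ (y.val * j.1.val) * (-1) ^ ((x + y).val * j.2.val) * η j, funext fun p => ?_⟩
    simp only [parity]
    push_cast
    ring
  · have e (ξ : Fin 2 → ℂ) (η : Fin 2 × Fin 2 → ℂ) :
        xForm s t u (fun p => ξ p.1 * η (p.2.1, p.2.2)) =
          pairForm (s 0) (t 0) (u 0) (s 3) (t 3) (u 3) (ξ 0) (ξ 1) (η (0, 0)) (η (1, 1)) +
          pairForm (s 1) (t 1) (u 1) (s 2) (t 2) (u 2) (ξ 0) (ξ 1) (η (0, 1)) (η (1, 0)) := by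
      simp [xForm, pairForm, Fin.sum_univ_four, pos, flip]
      ring
    simp only [e]
    rw [forall_pairForm_add_nonneg_iff (by decide), pairForm_nonneg_iff, pairForm_nonneg_iff,
      PairCondition]
    simp only [Fin.forall_fin_succ, Fin.forall_fin_zero]
    simp
    tauto

theorem hasXCriterion_beta : HasXCriterion (dualCone beta) 0 2 1 3 := by
  refine hasXCriterion_of_form (fun ξ η p => ξ p.2.1 * η (p.2.2, p.1)) (fun x y ξ η => ?_)
    fun s t u => ?_
  · refine ⟨fun i => (-1) ^ (y.val * i.val) * ξ i,
      fun j => (-1) ^ ((x + y).val * j.1.val) * (-1) ^ (x.val * j.2.val) * η j, funext fun p => ?_⟩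
    simp only [parity]
    push_cast
    ring
  · have e (ξ : Fin 2 → ℂ) (η : Fin 2 × Fin 2 → ℂ) :
        xForm s t u (fun p => ξ p.2.1 * η (p.2.2, p.1)) =
          pairForm (s 0) (t 0) (u 0) (t 2) (s 2) (star (u 2))
            (ξ 0) (ξ 1) (η (0, 0)) (η (1, 1)) +
          pairForm (s 1) (t 1) (u 1) (t 3) (s 3) (star (u 3))
            (ξ 0) (ξ 1) (η (1, 0)) (η (0, 1)) := by
      simp [xForm, pairForm, Fin.sum_univ_four, pos, flip]
      ring
    simp only [e]
    rw [forall_pairForm_add_nonneg_iff (by decide), pairForm_nonneg_iff, pairForm_nonneg_iff,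
      PairCondition]
    simp only [Fin.forall_fin_succ, Fin.forall_fin_zero, norm_star, mul_comm (t _)]
    simp
    tauto

theorem hasXCriterion_gamma : HasXCriterion (dualCone gamma) 0 1 2 3 := by
  refine hasXCriterion_of_form (fun ξ η p => ξ p.2.2 * η (p.1, p.2.1)) (fun x y ξ η => ?_)
    fun s t u => ?_
  · refine ⟨fun i => (-1) ^ ((x + y).val * i.val) * ξ i,
      fun j => (-1) ^ (x.val * j.1.val) * (-1) ^ (y.val * j.2.val) * η j, funext fun p => ?_⟩
    simp only [parity]
    push_cast
    ring
  · have e (ξ : Fin 2 → ℂ) (η : Fin 2 × Fin 2 → ℂ) :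
        xForm s t u (fun p => ξ p.2.2 * η (p.1, p.2.1)) =
          pairForm (s 0) (t 0) (u 0) (t 1) (s 1) (star (u 1))
            (ξ 0) (ξ 1) (η (0, 0)) (η (1, 1)) +
          pairForm (s 2) (t 2) (u 2) (t 3) (s 3) (star (u 3))
            (ξ 0) (ξ 1) (η (0, 1)) (η (1, 0)) := by
      simp [xForm, pairForm, Fin.sum_univ_four, pos, flip]
      ring
    simp only [e]
    rw [forall_pairForm_add_nonneg_iff (by decide), pairForm_nonneg_iff, pairForm_nonneg_iff,
      PairCondition]
    simp only [Fin.forall_fin_succ, Fin.forall_fin_zero, norm_star, mul_comm (t _)]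
    simp
    tauto

/-! ### The linear feasibility problem -/

/-- The linear problem of `exists_excess` when the couple `a`, `b` violates its inequality. A common
value `z` is used at `c` and `d`. It has to dominate `-za` and `-zb`, so the best choice is
`za = zb`, except when this would go below `-ua` or `-ub`. -/
theorem exists_excess_of_deficit {sa sb sc sd ua ub uc ud : ℝ} (hsa : 0 ≤ sa) (hsb : 0 ≤ sb)
    (hua : 0 ≤ ua) (hub : 0 ≤ ub) (huc : 0 ≤ uc) (hud : 0 ≤ ud)
    (hneg : sa + sb < ua + ub)
    (h3 : ua + ub + uc + ud ≤ sa + sb + sc + sd)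
    (hac : ua ≤ sa + sb + sc) (had : ua ≤ sa + sb + sd)
    (hbc : ub ≤ sa + sb + sc) (hbd : ub ≤ sa + sb + sd)
    (habc : ua + ub ≤ sa + sb + 2 * sc) (habd : ua + ub ≤ sa + sb + 2 * sd)
    (hcda : uc + ud + 2 * ua ≤ sc + sd + 2 * (sa + sb))
    (hcdb : uc + ud + 2 * ub ≤ sc + sd + 2 * (sa + sb)) :
    ∃ za zb z, (-ua ≤ za ∧ za ≤ sa) ∧ (-ub ≤ zb ∧ zb ≤ sb) ∧ (-uc ≤ z ∧ z ≤ sc) ∧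
      (-ud ≤ z ∧ z ≤ sd) ∧ za + zb ≤ sa + sb - (ua + ub) ∧ z + z ≤ sc + sd - (uc + ud) ∧
      0 ≤ za + z ∧ 0 ≤ zb + z := by
  -- If the deficit of `a`, `b` is more than twice `ua`, then `za` is clamped at `-ua`.
  rcases le_total (ua + sa + sb) ub with hb | hb
  · refine ⟨-ua, sa + sb - ub, ub - sa - sb, ?_⟩
    refine ⟨⟨?_, ?_⟩, ⟨?_, ?_⟩, ⟨?_, ?_⟩, ⟨?_, ?_⟩, ?_, ?_, ?_, ?_⟩ <;> linarith
  rcases le_total (ub + sa + sb) ua with ha | ha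
  · refine ⟨sa + sb - ua, -ub, ua - sa - sb, ?_⟩
    refine ⟨⟨?_, ?_⟩, ⟨?_, ?_⟩, ⟨?_, ?_⟩, ⟨?_, ?_⟩, ?_, ?_, ?_, ?_⟩ <;> linarith
  · refine ⟨-((ua + ub - sa - sb) / 2), -((ua + ub - sa - sb) / 2), (ua + ub - sa - sb) / 2, ?_⟩
    refine ⟨⟨?_, ?_⟩, ⟨?_, ?_⟩, ⟨?_, ?_⟩, ⟨?_, ?_⟩, ?_, ?_, ?_, ?_⟩ <;> linarith

/-- The linear problem behind the decomposition `W = P + Q`. For each index `m`, the number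
`z m` is the excess of `√(s m * t m)` over `|u m|` to be given to `Q`; any value between `-|u m|` and
`√(s m * t m)` can be realized. The first two inequalities on `z` say that the rest `P` satisfies the
condition for the couples `a, b` and `c, d`, the other four that `Q` satisfies the conditions for the
two other bipartitions. -/
theorem exists_excess {sa sb sc sd ua ub uc ud : ℝ} (hsa : 0 ≤ sa) (hsb : 0 ≤ sb)
    (hsc : 0 ≤ sc) (hsd : 0 ≤ sd)
    (hua : 0 ≤ ua) (hub : 0 ≤ ub) (huc : 0 ≤ uc) (hud : 0 ≤ ud)
    (h3 : ua + ub + uc + ud ≤ sa + sb + sc + sd)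
    (hac : ua ≤ sa + sb + sc) (had : ua ≤ sa + sb + sd)
    (hbc : ub ≤ sa + sb + sc) (hbd : ub ≤ sa + sb + sd)
    (hca : uc ≤ sc + sd + sa) (hcb : uc ≤ sc + sd + sb)
    (hda : ud ≤ sc + sd + sa) (hdb : ud ≤ sc + sd + sb)
    (habc : ua + ub ≤ sa + sb + 2 * sc) (habd : ua + ub ≤ sa + sb + 2 * sd)
    (hcda : uc + ud ≤ sc + sd + 2 * sa) (hcdb : uc + ud ≤ sc + sd + 2 * sb)
    (habc' : ua + ub + 2 * uc ≤ sa + sb + 2 * (sc + sd))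
    (habd' : ua + ub + 2 * ud ≤ sa + sb + 2 * (sc + sd))
    (hcda' : uc + ud + 2 * ua ≤ sc + sd + 2 * (sa + sb))
    (hcdb' : uc + ud + 2 * ub ≤ sc + sd + 2 * (sa + sb)) :
    ∃ za zb zc zd, (-ua ≤ za ∧ za ≤ sa) ∧ (-ub ≤ zb ∧ zb ≤ sb) ∧ (-uc ≤ zc ∧ zc ≤ sc) ∧
      (-ud ≤ zd ∧ zd ≤ sd) ∧ za + zb ≤ sa + sb - (ua + ub) ∧ zc + zd ≤ sc + sd - (uc + ud) ∧
      0 ≤ za + zc ∧ 0 ≤ zb + zd ∧ 0 ≤ za + zd ∧ 0 ≤ zb + zc := by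
  rcases lt_or_ge (sa + sb) (ua + ub) with hA | hA
  · obtain ⟨za, zb, z, ha, hb, hc, hd, h1, h2, h3, h4⟩ := exists_excess_of_deficit hsa hsb hua hub
      huc hud hA h3 hac had hbc hbd habc habd hcda' hcdb'
    exact ⟨za, zb, z, z, ha, hb, hc, hd, h1, h2, h3, h4, h3, h4⟩
  rcases lt_or_ge (sc + sd) (uc + ud) with hB | hB
  · obtain ⟨zc, zd, z, hc, hd, ha, hb, h2, h1, h3, h4⟩ := exists_excess_of_deficit hsc hsd huc hud
      hua hub hB (by linarith) hca hcb hda hdb hcda hcdb habc' habd'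
    exact ⟨z, z, zc, zd, ha, hb, hc, hd, h1, h2, by linarith, by linarith, by linarith, by linarith⟩
  · exact ⟨0, 0, 0, 0, by simp [*]⟩

/-! ### The inequalities in terms of four indices -/

theorem forall_fin_four_iff {i j k l : Fin 4} (h : ({i, j, k, l} : Finset (Fin 4)) = Finset.univ)
    {P : Fin 4 → Prop} : (∀ m, P m) ↔ P i ∧ P j ∧ P k ∧ P l := by
  have : (∀ m, P m) ↔ ∀ m ∈ ({i, j, k, l} : Finset (Fin 4)), P m := by simp [h]
  rw [this]
  simp

theorem pairwise_ne_of_eq_univ {i j k l : Fin 4}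
    (h : ({i, j, k, l} : Finset (Fin 4)) = Finset.univ) :
    i ≠ j ∧ i ≠ k ∧ i ≠ l ∧ j ≠ k ∧ j ≠ l ∧ k ≠ l := by
  revert i j k l; decide

theorem sum_fin_four_eq {i j k l : Fin 4} (h : ({i, j, k, l} : Finset (Fin 4)) = Finset.univ)
    (f : Fin 4 → ℝ) : ∑ m, f m = f i + f j + f k + f l := by
  obtain ⟨h1, h2, h3, h4, h5, h6⟩ := pairwise_ne_of_eq_univ h
  rw [← h, Finset.sum_insert (by simp [*]), Finset.sum_insert (by simp [*]),
    Finset.sum_insert (by simp [*]), Finset.sum_singleton]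
  ring

theorem sum_erase_eq {i j k l : Fin 4} (h : ({i, j, k, l} : Finset (Fin 4)) = Finset.univ)
    (f : Fin 4 → ℝ) : ∑ m ∈ Finset.univ.erase i, f m = f j + f k + f l := by
  have := Finset.add_sum_erase Finset.univ f (Finset.mem_univ i)
  rw [sum_fin_four_eq h] at this
  linarith

theorem complement_unique {i j k l : Fin 4} (h : ({i, j, k, l} : Finset (Fin 4)) = Finset.univ)
    {k' l' : Fin 4} (h' : ({i, j, k', l'} : Finset (Fin 4)) = Finset.univ) :
    k' = k ∧ l' = l ∨ k' = l ∧ l' = k := by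
  obtain ⟨h1, h2, h3, h4, h5, h6⟩ := pairwise_ne_of_eq_univ h
  obtain ⟨h1', h2', h3', h4', h5', h6'⟩ := pairwise_ne_of_eq_univ h'
  omega

theorem W2_iff {s t : Fin 4 → ℝ} {u : Fin 4 → ℂ} {i j k l : Fin 4}
    (h : ({i, j, k, l} : Finset (Fin 4)) = Finset.univ) :
    W2 s t u i j ↔ ‖u i‖ ≤ √(s i * t i) + √(s k * t k) + √(s l * t l) ∧
      ‖u j‖ ≤ √(s j * t j) + √(s k * t k) + √(s l * t l) := by
  rw [W2, sum_erase_eq h, sum_erase_eq (i := j) (j := i) (k := k) (l := l)]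
  rw [← h, Finset.insert_comm]

theorem W2_comm {s t : Fin 4 → ℝ} {u : Fin 4 → ℂ} {i j : Fin 4} :
    W2 s t u i j ↔ W2 s t u j i := and_comm

theorem W4_iff {s t : Fin 4 → ℝ} {u : Fin 4 → ℂ} {i j k l : Fin 4}
    (h : ({i, j, k, l} : Finset (Fin 4)) = Finset.univ) :
    W4 s t u i j ↔
      (‖u i‖ + ‖u j‖ ≤ √(s i * t i) + √(s j * t j) + 2 * √(s k * t k) ∧
        ‖u i‖ + ‖u j‖ ≤ √(s i * t i) + √(s j * t j) + 2 * √(s l * t l)) ∧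
      ‖u i‖ + ‖u j‖ + 2 * ‖u k‖ ≤
          √(s i * t i) + √(s j * t j) + 2 * (√(s k * t k) + √(s l * t l)) ∧
        ‖u i‖ + ‖u j‖ + 2 * ‖u l‖ ≤
          √(s i * t i) + √(s j * t j) + 2 * (√(s k * t k) + √(s l * t l)) := by
  have hmin (x y a b : ℝ) : x ≤ y + 2 * min a b ↔ x ≤ y + 2 * a ∧ x ≤ y + 2 * b := by
    rw [mul_min_of_nonneg _ _ zero_le_two, ← min_add_add_left, le_min_iff]
  have hmax (x y a b : ℝ) : x + 2 * max a b ≤ y ↔ x + 2 * a ≤ y ∧ x + 2 * b ≤ y := by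
    rw [mul_max_of_nonneg _ _ zero_le_two, ← max_add_add_left, max_le_iff]
  rw [← hmin, ← hmax]
  refine and_congr ⟨fun H => H k l h, fun H k' l' h' => ?_⟩
    ⟨fun H => H k l h, fun H k' l' h' => ?_⟩
  · obtain ⟨rfl, rfl⟩ | ⟨rfl, rfl⟩ := complement_unique h h'
    · exact H
    · rwa [min_comm]
  · obtain ⟨rfl, rfl⟩ | ⟨rfl, rfl⟩ := complement_unique h h'
    · exact H
    · rwa [max_comm, add_comm √(s k' * t k')]

/-- The inequalities for the join whose first cone belongs to the bipartition coupling `i` with `j`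
and `k` with `l`. -/
def JoinCondition (s t : Fin 4 → ℝ) (u : Fin 4 → ℂ) (i j k l : Fin 4) : Prop :=
  (W3 s t u ∧ (W2 s t u i k ∧ W2 s t u i l ∧ W2 s t u j k ∧ W2 s t u j l) ∧
    (W4 s t u i j ∧ W4 s t u k l))

theorem quadruple_permutations {i j k l : Fin 4} (h : ({i, j, k, l} : Finset (Fin 4)) = Finset.univ) :
    ({i, k, j, l} : Finset (Fin 4)) = Finset.univ ∧ ({i, l, j, k} : Finset (Fin 4)) = Finset.univ ∧
    ({j, k, i, l} : Finset (Fin 4)) = Finset.univ ∧ ({j, l, i, k} : Finset (Fin 4)) = Finset.univ ∧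
    ({k, l, i, j} : Finset (Fin 4)) = Finset.univ := by
  refine ⟨?_, ?_, ?_, ?_, ?_⟩ <;> rw [← h] <;> ext m <;>
    simp only [Finset.mem_insert, Finset.mem_singleton] <;> tauto

/-! ### Elements of the join and their X-parts -/

theorem joinCondition_of_mem {a b c : PointedCone ℝ SA} {i j k l : Fin 4}
    (h : ({i, j, k, l} : Finset (Fin 4)) = Finset.univ)
    (ha : HasXCriterion a i j k l) (hb : HasXCriterion b i k j l) (hc : HasXCriterion c i l j k)
    {W : SA} {s t : Fin 4 → ℝ} {u : Fin 4 → ℂ} (hX : xPart W.1 = xMatrix s t u)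
    (hW : W ∈ a ⊔ (b ⊓ c)) : (∀ m, 0 ≤ s m ∧ 0 ≤ t m) ∧ JoinCondition s t u i j k l := by
  obtain ⟨P, hP, Q, ⟨hQb, hQc⟩, rfl⟩ := Submodule.mem_sup.1 hW
  obtain ⟨s₁, t₁, u₁, hX₁⟩ := exists_xPart_eq_xMatrix P
  obtain ⟨s₂, t₂, u₂, hX₂⟩ := exists_xPart_eq_xMatrix Q
  have hsum : xPart (P + Q).1 = xMatrix (s₁ + s₂) (t₁ + t₂) (u₁ + u₂) := by
    rw [xMatrix_add, ← hX₁, ← hX₂, ← xPart_add]; rfl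
  obtain ⟨rfl, rfl, rfl⟩ := xMatrix_injective (hX.symm.trans hsum)
  obtain ⟨hn₁, ha₁, ha₂⟩ := ha.necessary hX₁ hP
  obtain ⟨hn₂, hb₁, hb₂⟩ := hb.necessary hX₂ hQb
  obtain ⟨-, hc₁, hc₂⟩ := hc.necessary hX₂ hQc
  have hu (m) : ‖(u₁ + u₂) m‖ ≤ ‖u₁ m‖ + ‖u₂ m‖ := norm_add_le _ _
  have hr (m) : √(s₁ m * t₁ m) + √(s₂ m * t₂ m) ≤ √((s₁ + s₂) m * (t₁ + t₂) m) :=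
    sqrt_add_sqrt_le (hn₁ m).1 (hn₁ m).2 (hn₂ m).1 (hn₂ m).2
  refine ⟨fun m => ⟨add_nonneg (hn₁ m).1 (hn₂ m).1, add_nonneg (hn₁ m).2 (hn₂ m).2⟩, ?_⟩
  obtain ⟨p1, p2, p3, p4, p5⟩ := quadruple_permutations h
  simp only [JoinCondition, W3, sum_fin_four_eq h, W2_iff p1, W2_iff p2, W2_iff p3, W2_iff p4,
    W4_iff h, W4_iff p5]
  have hu₁ (m) := norm_nonneg (u₁ m)
  have hu₂ (m) := norm_nonneg (u₂ m)
  have hr₁ (m) := Real.sqrt_nonneg (s₁ m * t₁ m)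
  have hr₂ (m) := Real.sqrt_nonneg (s₂ m * t₂ m)
  rw [forall_fin_four_iff h] at hu hr hu₁ hu₂ hr₁ hr₂
  generalize ‖(u₁ + u₂) i‖ = x1, ‖(u₁ + u₂) j‖ = x2, ‖(u₁ + u₂) k‖ = x3, ‖(u₁ + u₂) l‖ = x4 at *
  generalize √((s₁ + s₂) i * (t₁ + t₂) i) = y1, √((s₁ + s₂) j * (t₁ + t₂) j) = y2,
    √((s₁ + s₂) k * (t₁ + t₂) k) = y3, √((s₁ + s₂) l * (t₁ + t₂) l) = y4 at *
  obtain ⟨_, _, _, _⟩ := hu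
  obtain ⟨_, _, _, _⟩ := hr
  obtain ⟨_, _, _, _⟩ := hu₁
  obtain ⟨_, _, _, _⟩ := hu₂
  obtain ⟨_, _, _, _⟩ := hr₁
  obtain ⟨_, _, _, _⟩ := hr₂
  clear hn₁ hn₂ hX hX₁ hX₂ hsum ha hb hc
  refine ⟨?_, ⟨⟨?_, ?_⟩, ⟨?_, ?_⟩, ⟨?_, ?_⟩, ⟨?_, ?_⟩⟩, ⟨⟨?_, ?_⟩, ?_, ?_⟩, ⟨?_, ?_⟩, ?_, ?_⟩ <;>
    linarith

/-- A value `z` in `[-U, S]` is the excess `a S - b U` for some fractions `a` and `b`. When `S = 0` or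
`U = 0`, the junk value `z / 0 = 0` is the right fraction, as then `z = 0`. -/
theorem exists_ratio {S U z : ℝ} (hS : 0 ≤ S) (hU : 0 ≤ U) (h1 : -U ≤ z) (h2 : z ≤ S) :
    ∃ a b : ℝ, (0 ≤ a ∧ a ≤ 1) ∧ (0 ≤ b ∧ b ≤ 1) ∧ a * S - b * U = z := by
  rcases le_total 0 z with hz | hz
  · refine ⟨z / S, 0, ⟨by positivity, div_le_one_of_le₀ h2 hS⟩, by simp, ?_⟩
    rw [div_mul_cancel_of_imp (by intro; linarith)]; ring
  · refine ⟨0, -z / U, by simp, ⟨div_nonneg (by linarith) hU, div_le_one_of_le₀ (by linarith) hU⟩, ?_⟩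
    rw [div_mul_cancel_of_imp (by intro; linarith)]; ring

theorem sqrt_smul_mul_smul {c : ℝ} (hc : 0 ≤ c) (x y : ℝ) :
    √(c * x * (c * y)) = c * √(x * y) := by
  rw [show c * x * (c * y) = c ^ 2 * (x * y) by ring, Real.sqrt_mul (by positivity),
    Real.sqrt_sq hc]

/-- The decomposition scales the entries at each index `m`: `Q` receives the fraction `x m` of
`s m` and `t m` and the fraction `y m` of `u m`, and `P` the rest. -/
theorem mem_of_joinCondition {a b c : PointedCone ℝ SA} {i j k l : Fin 4}
    (h : ({i, j, k, l} : Finset (Fin 4)) = Finset.univ)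
    (ha : HasXCriterion a i j k l) (hb : HasXCriterion b i k j l) (hc : HasXCriterion c i l j k)
    {W : SA} {s t : Fin 4 → ℝ} {u : Fin 4 → ℂ} (hX : xPart W.1 = xMatrix s t u)
    (hW : IsXShaped W.1) (hn : ∀ m, 0 ≤ s m ∧ 0 ≤ t m) (hj : JoinCondition s t u i j k l) :
    W ∈ a ⊔ (b ⊓ c) := by
  obtain ⟨p1, p2, p3, p4, p5⟩ := quadruple_permutations h
  simp only [JoinCondition, W3, sum_fin_four_eq h, W2_iff p1, W2_iff p2, W2_iff p3, W2_iff p4,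
    W4_iff h, W4_iff p5] at hj
  obtain ⟨h3, ⟨⟨h21, h22⟩, ⟨h23, h24⟩, ⟨h25, h26⟩, ⟨h27, h28⟩⟩, ⟨⟨h41, h42⟩, h43, h44⟩,
    ⟨h45, h46⟩, h47, h48⟩ := hj
  have hS (m) := Real.sqrt_nonneg (s m * t m)
  have hU (m) := norm_nonneg (u m)
  obtain ⟨za, zb, zc, zd, bi, bj, bk, bl, e1, e2, e3, e4, e5, e6⟩ := exists_excess
    (hS i) (hS j) (hS k) (hS l) (hU i) (hU j) (hU k) (hU l) (by linarith only [h3])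
    (by linarith only [h23]) (by linarith only [h21]) (by linarith only [h27])
    (by linarith only [h25]) (by linarith only [h26]) (by linarith only [h22])
    (by linarith only [h28]) (by linarith only [h24]) h41 h42 h45 h46 h43 h44 h47 h48
  obtain ⟨z, rfl, rfl, rfl, rfl⟩ : ∃ z : Fin 4 → ℝ, z i = za ∧ z j = zb ∧ z k = zc ∧ z l = zd := by
    obtain ⟨n1, n2, n3, n4, n5, n6⟩ := pairwise_ne_of_eq_univ h
    exact ⟨fun m => if m = i then za else if m = j then zb else if m = k then zc else zd, by
      simp [n1.symm, n2.symm, n3.symm, n4.symm, n5.symm, n6.symm]⟩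
  have hz : ∀ m, -‖u m‖ ≤ z m ∧ z m ≤ √(s m * t m) :=
    (forall_fin_four_iff h).2 ⟨bi, bj, bk, bl⟩
  choose x y hx hy hxy using fun m => exists_ratio (hS m) (hU m) (hz m).1 (hz m).2
  have hx' (m) : 0 ≤ 1 - x m := by linarith [(hx m).2]
  have hy' (m) : 0 ≤ 1 - y m := by linarith [(hy m).2]
  have nu (m) : ‖(y m : ℂ) * u m‖ = y m * ‖u m‖ := by
    rw [norm_mul, Complex.norm_of_nonneg (hy m).1]
  have nu' (m) : ‖((1 - y m : ℝ) : ℂ) * u m‖ = (1 - y m) * ‖u m‖ := by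
    rw [norm_mul, Complex.norm_of_nonneg (hy' m)]
  have hsplit : W = xState (fun m => (1 - x m) * s m) (fun m => (1 - x m) * t m)
        (fun m => ((1 - y m : ℝ) : ℂ) * u m) +
      xState (fun m => x m * s m) (fun m => x m * t m) (fun m => (y m : ℂ) * u m) := by
    rw [eq_xState hX hW, ← xState_add]
    congr 1 <;> ext m <;> simp only [Pi.add_apply] <;> push_cast <;> ring
  rw [hsplit]
  refine Submodule.add_mem_sup (ha.sufficient ?_) ⟨hb.sufficient ?_, hc.sufficient ?_⟩
  · refine ⟨fun m => ⟨mul_nonneg (hx' m) (hn m).1, mul_nonneg (hx' m) (hn m).2⟩, ?_⟩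
    simp only [nu', sqrt_smul_mul_smul (hx' _)]
    constructor <;> linarith only [hxy i, hxy j, hxy k, hxy l, e1, e2, e3, e4, e5, e6]
  all_goals
    refine ⟨fun m => ⟨mul_nonneg (hx m).1 (hn m).1, mul_nonneg (hx m).1 (hn m).2⟩, ?_⟩
    simp only [nu, sqrt_smul_mul_smul (hx _).1]
    constructor <;> linarith only [hxy i, hxy j, hxy k, hxy l, e1, e2, e3, e4, e5, e6]

end ThreeQubit

end

open ThreeQubit in
theorem theorem4p1 (W : SA) (s t : Fin 4 → ℝ) (u : Fin 4 → ℂ)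
    (hX : xPart W.1 = xMatrix s t u) :
    -- necessity, for arbitrary self-adjoint `W`
    ((W ∈ dualCone alpha ⊔ (dualCone beta ⊓ dualCone gamma) →
        (∀ i, 0 ≤ s i ∧ 0 ≤ t i) ∧ W3 s t u ∧
        (W2 s t u 0 1 ∧ W2 s t u 0 2 ∧ W2 s t u 1 3 ∧ W2 s t u 2 3) ∧
        (W4 s t u 0 3 ∧ W4 s t u 1 2)) ∧
      (W ∈ dualCone beta ⊔ (dualCone gamma ⊓ dualCone alpha) →
        (∀ i, 0 ≤ s i ∧ 0 ≤ t i) ∧ W3 s t u ∧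
        (W2 s t u 0 1 ∧ W2 s t u 0 3 ∧ W2 s t u 1 2 ∧ W2 s t u 2 3) ∧
        (W4 s t u 0 2 ∧ W4 s t u 1 3)) ∧
      (W ∈ dualCone gamma ⊔ (dualCone alpha ⊓ dualCone beta) →
        (∀ i, 0 ≤ s i ∧ 0 ≤ t i) ∧ W3 s t u ∧
        (W2 s t u 0 2 ∧ W2 s t u 0 3 ∧ W2 s t u 1 2 ∧ W2 s t u 1 3) ∧
        (W4 s t u 0 1 ∧ W4 s t u 2 3))) ∧
    -- sufficiency, for X-shaped `W` with nonnegative diagonal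
    (IsXShaped W.1 → (∀ i, 0 ≤ s i ∧ 0 ≤ t i) → W3 s t u →
      ((W2 s t u 0 1 ∧ W2 s t u 0 2 ∧ W2 s t u 1 3 ∧ W2 s t u 2 3) →
        (W4 s t u 0 3 ∧ W4 s t u 1 2) →
        W ∈ dualCone alpha ⊔ (dualCone beta ⊓ dualCone gamma)) ∧
      ((W2 s t u 0 1 ∧ W2 s t u 0 3 ∧ W2 s t u 1 2 ∧ W2 s t u 2 3) →
        (W4 s t u 0 2 ∧ W4 s t u 1 3) →
        W ∈ dualCone beta ⊔ (dualCone gamma ⊓ dualCone alpha)) ∧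
      ((W2 s t u 0 2 ∧ W2 s t u 0 3 ∧ W2 s t u 1 2 ∧ W2 s t u 1 3) →
        (W4 s t u 0 1 ∧ W4 s t u 2 3) →
        W ∈ dualCone gamma ⊔ (dualCone alpha ⊓ dualCone beta))) := by

  have hα := hasXCriterion_alpha
  have hβ := hasXCriterion_beta
  have hγ := hasXCriterion_gamma
  refine ⟨⟨fun h => ?_, fun h => ?_, fun h => ?_⟩, fun hs hn h3 =>
    ⟨fun h2 h4 => ?_, fun h2 h4 => ?_, fun h2 h4 => ?_⟩⟩
  · rw [inf_comm] at h
    simpa only [JoinCondition, W2_comm (i := 3)] using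
      joinCondition_of_mem (by decide) hα hγ.swap hβ.swap hX h
  · simpa only [JoinCondition, W2_comm (i := 2) (j := 1)] using
      joinCondition_of_mem (by decide) hβ hγ hα.swap hX h
  · rw [inf_comm] at h
    simpa only [JoinCondition] using joinCondition_of_mem (by decide) hγ hβ hα hX h
  · rw [inf_comm]
    refine mem_of_joinCondition (by decide) hα hγ.swap hβ.swap hX hs hn ?_
    simpa only [JoinCondition, W2_comm (i := 3)] using ⟨h3, h2, h4⟩
  · refine mem_of_joinCondition (by decide) hβ hγ hα.swap hX hs hn ?_
    simpa only [JoinCondition, W2_comm (i := 2) (j := 1)] using ⟨h3, h2, h4⟩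
  · rw [inf_comm]
    exact mem_of_joinCondition (by decide) hγ hβ hα hX hs hn ⟨h3, h2, h4⟩
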